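/- Let $\mathbb H$ be the upper half plane. For $k=1,2,3$ and $z\in\mathbb H$ put $$g_k(z)=a_k\Big(1+(-1)^k\frac{4k}{\beta_k}\sum_{n\ge 1}\sigma_{2k-1}(n)e^{2\pi i nz}\Big),$$ where $\beta_1=\tfrac16,\ \beta_2=\tfrac1{30},\ \beta_3=\tfrac1{42}$ (the absolute values of the Bernoulli numbers of index $2k$), $\sigma_i(n)=\sum_{d\mid n}d^i$, and $$a_1=2\zeta(2)\frac{-1}{2\pi i},\qquad a_2=2\zeta(4)\frac{60}{(2\pi i)^2},\qquad a_3=2\zeta(6)\frac{-140}{(2\pi i)^3}.$$ Let $T=\mathbb C^3\setminus\{(t_1,t_2,t_3): 27t_3^2-t_2^3=0\}$. Then $g=(g_1,g_2,g_3)$ maps $\mathbb H$ into $T$, and there is a unique triple of real-analytic functions $B_1,B_2:T\to\mathbb R$, $B_3:T\to\mathbb C$ such that $B_1$ does not depend on the variable $t_1$, such that for all $z\in\mathbb H$ $$B_1(g(z))=\operatorname{Im}z,\qquad B_2(g(z))=0,\qquad B_3(g(z))=1,$$ and such that for all $t=(t_1,t_2,t_3)\in T$, $k\in\mathbb C^*$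 and $k'\in\mathbb C$ $$B_1(t_1,t_2k^{-4},t_3k^{-6})=B_1(t)|k|^2,$$ $$B_2(t_1k^{-2}+k'k^{-1},t_2k^{-4},t_3k^{-6})=B_1(t)|k'|^2+B_2(t)|k^{-1}|^2+\operatorname{Im}\big(B_3(t)\,k'\,\overline{k^{-1}}\big),$$ $$B_3(t_1k^{-2}+k'k^{-1},t_2k^{-4},t_3k^{-6})=B_3(t)\,k\,\overline{k^{-1}}+2\sqrt{-1}\,k\,\overline{k'}\,B_1(t).$$ Moreover, $|B_3(t)|=1$ for every $t\in T$ with $B_2(t)=0$. -/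

import Mathlib

open scoped UpperHalfPlane ComplexConjugate

/-- The series `a * (1 + (-1)^k * (4k / B_k) * ∑_{n ≥ 1} σ_{2k-1}(n) e^{2πinz})` on the upper half
plane, where `B_1 = 1/6`, `B_2 = 1/30`, `B_3 = 1/42`, ... are the classical (positive) Bernoulli
numbers, i.e. the absolute values of the Bernoulli numbers of even index `2k`. -/
noncomputable def eisQSeries (a : ℂ) (k : ℕ) (z : ℍ) : ℂ :=
  a * (1 + (-1) ^ k * (4 * (k : ℂ) / ((|bernoulli (2 * k)| : ℚ) : ℂ)) *
    ∑' n : ℕ+, (ArithmeticFunction.sigma (2 * k - 1) (n : ℕ) : ℂ) *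
      Complex.exp (2 * (Real.pi : ℂ) * Complex.I * (z : ℂ) * ((n : ℕ) : ℂ)))

/-- The normalised Eisenstein series of weight 2, with constant term `2ζ(2) * (-1) / (2πi)`. -/
noncomputable def eisG1 : ℍ → ℂ :=
  eisQSeries (2 * riemannZeta 2 * (-1 / (2 * (Real.pi : ℂ) * Complex.I))) 1

/-- The normalised Eisenstein series of weight 4, with constant term `2ζ(4) * 60 / (2πi)^2`. -/
noncomputable def eisG2 : ℍ → ℂ :=
  eisQSeries (2 * riemannZeta 4 * (60 / (2 * (Real.pi : ℂ) * Complex.I) ^ 2)) 2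

/-- The normalised Eisenstein series of weight 6, with constant term `2ζ(6) * (-140) / (2πi)^3`. -/
noncomputable def eisG3 : ℍ → ℂ :=
  eisQSeries (2 * riemannZeta 6 * (-140 / (2 * (Real.pi : ℂ) * Complex.I) ^ 3)) 3

/-- The map `g = (g₁, g₂, g₃) : ℍ → ℂ³`. -/
noncomputable def eisMap (z : ℍ) : ℂ × ℂ × ℂ := (eisG1 z, eisG2 z, eisG3 z)

/-- `T = ℂ³ \ {27 t₃² - t₂³ = 0}`. -/
def regularLocus : Set (ℂ × ℂ × ℂ) := {t | 27 * t.2.2 ^ 2 - t.2.1 ^ 3 ≠ 0}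

/-- `T` is stable under `(t₁, t₂, t₃) ↦ (s, t₂ k⁻⁴, t₃ k⁻⁶)`, for nonzero `k` and arbitrary `s`. -/
theorem mem_regularLocus_of_scale (k : ℂˣ) (s : ℂ) {t : ℂ × ℂ × ℂ} (ht : t ∈ regularLocus) :
    (s, t.2.1 * (k : ℂ)⁻¹ ^ 4, t.2.2 * (k : ℂ)⁻¹ ^ 6) ∈ regularLocus := by
  have hk : (k : ℂ)⁻¹ ^ 12 ≠ 0 := pow_ne_zero _ (inv_ne_zero k.ne_zero)
  have h : 27 * (t.2.2 * (k : ℂ)⁻¹ ^ 6) ^ 2 - (t.2.1 * (k : ℂ)⁻¹ ^ 4) ^ 3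
      = (27 * t.2.2 ^ 2 - t.2.1 ^ 3) * (k : ℂ)⁻¹ ^ 12 := by ring
  change 27 * (t.2.2 * (k : ℂ)⁻¹ ^ 6) ^ 2 - (t.2.1 * (k : ℂ)⁻¹ ^ 4) ^ 3 ≠ 0
  rw [h]
  exact mul_ne_zero ht hk

/-- The point `(t₁, t₂ k⁻⁴, t₃ k⁻⁶)` of `T`. -/
noncomputable def scaleT (k : ℂˣ) (t : regularLocus) : regularLocus :=
  ⟨(t.1.1, t.1.2.1 * (k : ℂ)⁻¹ ^ 4, t.1.2.2 * (k : ℂ)⁻¹ ^ 6),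
    mem_regularLocus_of_scale k _ t.2⟩

/-- The point `t • g = (t₁ k⁻² + k' k⁻¹, t₂ k⁻⁴, t₃ k⁻⁶)` of `T`, for the upper triangular matrix
`g` with rows `(k, k')` and `(0, k⁻¹)`. -/
noncomputable def actT (k : ℂˣ) (k' : ℂ) (t : regularLocus) : regularLocus :=
  ⟨(t.1.1 * (k : ℂ)⁻¹ ^ 2 + k' * (k : ℂ)⁻¹,
      t.1.2.1 * (k : ℂ)⁻¹ ^ 4, t.1.2.2 * (k : ℂ)⁻¹ ^ 6),
    mem_regularLocus_of_scale k _ t.2⟩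

/-- Real-analyticity of a function on the open subset `T` of `ℂ³ = ℝ⁶`: some (equivalently, any)
extension of `f` to `ℂ³` has a real power series expansion around each point of `T`. -/
def RealAnalyticOnT {E : Type*} [NormedAddCommGroup E] [NormedSpace ℝ E]
    (f : regularLocus → E) : Prop :=
  ∃ F : ℂ × ℂ × ℂ → E, AnalyticOnNhd ℝ F regularLocus ∧ ∀ t : regularLocus, F t = f t

/-- The defining properties of the triple `(B₁, B₂, B₃)` of functions on `T`; `hg` says that `g`
takes its values in `T`, so that the compositions `Bᵢ ∘ g` make sense. -/
structure IsBTriple (hg : ∀ z : ℍ, eisMap z ∈ regularLocus)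
    (B₁ B₂ : regularLocus → ℝ) (B₃ : regularLocus → ℂ) : Prop where
  analytic₁ : RealAnalyticOnT B₁
  analytic₂ : RealAnalyticOnT B₂
  analytic₃ : RealAnalyticOnT B₃
  /-- `B₁` does not depend on `t₁`. -/
  indep₁ : ∀ s t : regularLocus, s.1.2 = t.1.2 → B₁ s = B₁ t
  comp₁ : ∀ z : ℍ, B₁ ⟨eisMap z, hg z⟩ = z.im
  law₁ : ∀ (k : ℂˣ) (t : regularLocus), B₁ (scaleT k t) = B₁ t * ‖(k : ℂ)‖ ^ 2
  comp₂ : ∀ z : ℍ, B₂ ⟨eisMap z, hg z⟩ = 0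
  law₂ : ∀ (k : ℂˣ) (k' : ℂ) (t : regularLocus),
    B₂ (actT k k' t) = B₁ t * ‖k'‖ ^ 2 + B₂ t * ‖(k : ℂ)⁻¹‖ ^ 2
      + (B₃ t * k' * conj ((k : ℂ)⁻¹)).im
  comp₃ : ∀ z : ℍ, B₃ ⟨eisMap z, hg z⟩ = 1
  law₃ : ∀ (k : ℂˣ) (k' : ℂ) (t : regularLocus),
    B₃ (actT k k' t) = B₃ t * (k : ℂ) * conj ((k : ℂ)⁻¹)
      + 2 * Complex.I * (k : ℂ) * conj k' * (B₁ t : ℂ)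

/-!
A point `t` of `T` corresponds to a lattice `k (ℤ z + ℤ)` via `t₂ = g₂(z) k⁻⁴`, `t₃ = g₃(z) k⁻⁶`,
together with the number `k'` determined by `t₁ = g₁(z) k⁻² + k' k⁻¹`. These data are recorded in a
period matrix of determinant one with columns `α = (k z, k)` and `β = (z k' - k⁻¹, k')`, which is
well defined up to left multiplication by `SL(2, ℤ)`. The functions

`B₁ = Im (α₁ conj α₂)`, `B₂ = Im (β₁ conj β₂)`, `B₃ = α₁ conj β₂ - α₂ conj β₁`

are invariant under this multiplication, and acting on `t` by an upper triangular matrix replaces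
`(α, β)` by `(k α, k' α + k⁻¹ β)`, which gives the functional equations. They determine the triple,
because every point of `T` is obtained in this way from a point of `g(ℍ)`. The last claim follows
from `|B₃|² = 4 B₁ B₂ + |det|²` with `det = 1` (`norm_skewPairing_sq`).

Three facts about the map `(z, k) ↦ (g₂(z) k⁻⁴, g₃(z) k⁻⁶)` carry the argument.

* It is injective modulo `SL(2, ℤ)` (`exists_smul_of_eisG_eq`): the invariants `g₂`, `g₃` determine
  the Weierstrass function through its differential equation, and its poles are the lattice.
* It is onto the pairs with `27 t₃² ≠ t₂³` (`exists_eisG_eq`): the modular invariant is open and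
  proper modulo `SL(2, ℤ)`, hence surjective onto `ℂ`.
* It has local analytic sections (`exists_analytic_section`): its Jacobian is a multiple of the
  Wronskian of `E₄` and `E₆`, a nonzero cusp form of weight `12`, that is, a multiple of `Δ`.

That `g₁` transforms compatibly is the quasi-modularity of `E₂`, and `g(ℍ) ⊆ T` is the nonvanishing
of `Δ = (E₄³ - E₆²) / 1728`.
-/

/-! ### The series as Eisenstein series -/

theorem eisG1_eq (z : ℍ) : eisG1 z = Real.pi * Complex.I / 6 * EisensteinSeries.E2 z := by
  have hb : bernoulli 2 = 1 / 6 := by decide +kernel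
  have hpi : (Real.pi : ℂ) ≠ 0 := by exact_mod_cast Real.pi_ne_zero
  have hs (n : ℕ+) : Complex.exp (2 * (Real.pi : ℂ) * Complex.I * (z : ℂ) * ((n : ℕ) : ℂ)) =
      Complex.exp (2 * Real.pi * Complex.I * z) ^ (n : ℕ) := by
    rw [← Complex.exp_nat_mul]; ring_nf
  rw [EisensteinSeries.E2_eq_tsum_cexp, eisG1, eisQSeries, riemannZeta_two]
  simp only [hs]
  norm_num [hb]
  field_simp
  rw [Complex.I_sq]
  ring

theorem eisG2_eq (z : ℍ) : eisG2 z = -(Real.pi ^ 2 / 3) * ModularForm.E₄ z := by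
  have hb : bernoulli 4 = -1 / 30 := by decide +kernel
  have hpi : (Real.pi : ℂ) ≠ 0 := by exact_mod_cast Real.pi_ne_zero
  have hs (n : ℕ+) : Complex.exp (2 * (Real.pi : ℂ) * Complex.I * (z : ℂ) * ((n : ℕ) : ℂ)) =
      Complex.exp (2 * Real.pi * Complex.I * z) ^ (n : ℕ) := by
    rw [← Complex.exp_nat_mul]; ring_nf
  rw [EisensteinSeries.q_expansion_bernoulli _ ⟨2, rfl⟩, eisG2, eisQSeries, riemannZeta_four]
  simp only [hs, zpow_natCast]
  norm_num [hb, abs_div, mul_pow, Complex.I_sq]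
  field_simp
  ring

theorem eisG3_eq (z : ℍ) :
    eisG3 z = -(Complex.I * Real.pi ^ 3 / 27) * ModularForm.E₆ z := by
  have hb : bernoulli 6 = 1 / 42 := by decide +kernel
  have hpi : (Real.pi : ℂ) ≠ 0 := by exact_mod_cast Real.pi_ne_zero
  have hs (n : ℕ+) : Complex.exp (2 * (Real.pi : ℂ) * Complex.I * (z : ℂ) * ((n : ℕ) : ℂ)) =
      Complex.exp (2 * Real.pi * Complex.I * z) ^ (n : ℕ) := by
    rw [← Complex.exp_nat_mul]; ring_nf
  have hz : riemannZeta 6 = Real.pi ^ 6 / 945 := by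
    have := riemannZeta_two_mul_nat (k := 3) (by norm_num)
    norm_num [hb, Nat.factorial] at this
    rw [this]; ring
  rw [EisensteinSeries.q_expansion_bernoulli _ ⟨3, rfl⟩, eisG3, eisQSeries, hz]
  simp only [hs, zpow_natCast]
  norm_num [hb, abs_div, mul_pow, Complex.I_pow_three]
  field_simp
  rw [Complex.I_sq]
  ring

theorem discr_eisMap (z : ℍ) :
    27 * eisG3 z ^ 2 - eisG2 z ^ 3 = 64 * Real.pi ^ 6 * ModularForm.discriminant z := by
  rw [ModularForm.discriminant_eq_E₄_cube_sub_E₆_sq, eisG2_eq, eisG3_eq]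
  ring_nf
  rw [Complex.I_sq]
  ring

theorem eisMap_mem_regularLocus (z : ℍ) : eisMap z ∈ regularLocus := by
  change 27 * eisG3 z ^ 2 - eisG2 z ^ 3 ≠ 0
  rw [discr_eisMap]
  have hpi : (Real.pi : ℂ) ≠ 0 := by exact_mod_cast Real.pi_ne_zero
  exact mul_ne_zero (mul_ne_zero (by norm_num) (pow_ne_zero 6 hpi))
    (ModularForm.discriminant_ne_zero z)

/-! ### Behaviour under the modular group -/

open MatrixGroups in
theorem levelOne_smul {k : ℕ} (f : ModularForm 𝒮ℒ k) (γ : SL(2, ℤ)) (z : ℍ) :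
    f (γ • z) = UpperHalfPlane.denom γ z ^ k * f z := by
  have h := congrFun (SlashInvariantForm.slash_action_eqn f γ ⟨γ, rfl⟩) z
  have h' := ModularForm.SL_slash_apply (f := ⇑f) (k := k) γ z
  rw [← ModularForm.SL_slash] at h
  rw [h, zpow_neg, zpow_natCast,
    eq_mul_inv_iff_mul_eq₀ (pow_ne_zero _ (UpperHalfPlane.denom_ne_zero γ z))] at h'
  rw [← h', mul_comm]

open MatrixGroups in
theorem eisG1_smul (γ : SL(2, ℤ)) (z : ℍ) :
    eisG1 (γ • z) = UpperHalfPlane.denom γ z ^ 2 * eisG1 z + γ 1 0 * UpperHalfPlane.denom γ z := by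
  have h := congrFun (EisensteinSeries.E2_slash_action γ) z
  have hd := UpperHalfPlane.denom_ne_zero γ z
  have hpi : (Real.pi : ℂ) ≠ 0 := by exact_mod_cast Real.pi_ne_zero
  rw [ModularForm.SL_slash_apply] at h
  simp only [Pi.sub_apply, Pi.smul_apply, EisensteinSeries.D2, riemannZeta_two, smul_eq_mul] at h
  rw [zpow_neg, mul_inv_eq_iff_eq_mul₀ (zpow_ne_zero _ hd)] at h
  rw [eisG1_eq, eisG1_eq, h]
  have h2 := Complex.I_sq
  field_simp
  linear_combination (-6 * (γ 1 0 : ℂ)) * h2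

/-! ### A lattice is determined by its invariants -/

section Lattice

open Filter Topology

namespace PeriodPair

/-- The invariants determine the regular part of `℘` at `0`. If the difference `D` of the two regular
parts had a zero of finite order `n` at `0`, write `D = zⁿ h` with `h 0 ≠ 0`, subtract the two
differential equations `℘'² = 4 ℘³ - g₂ ℘ - g₃`, multiply by `z⁴` and divide by `zⁿ`; letting
`z → 0` gives `-4 n = 12`, which is impossible. -/
theorem eventually_weierstrassPExcept_eq {L M : PeriodPair} (h₂ : L.g₂ = M.g₂)
    (h₃ : L.g₃ = M.g₃) :
    ∀ᶠ z in 𝓝 0, L.weierstrassPExcept 0 z = M.weierstrassPExcept 0 z := by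
  have hL0 : (0 : ℂ) ∈ L.lattice := zero_mem _
  have hM0 : (0 : ℂ) ∈ M.lattice := zero_mem _
  have hD : AnalyticAt ℂ (fun z ↦ L.weierstrassPExcept 0 z - M.weierstrassPExcept 0 z) 0 :=
    (L.analyticAt_weierstrassPExcept 0).sub (M.analyticAt_weierstrassPExcept 0)
  suffices ∀ᶠ z in 𝓝 0, L.weierstrassPExcept 0 z - M.weierstrassPExcept 0 z = 0 by
    filter_upwards [this] with z hz using sub_eq_zero.mp hz
  by_contra hne
  obtain ⟨n, h, hh, hh0, hDh⟩ := hD.exists_eventuallyEq_pow_smul_nonzero_iff.mpr hne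
  simp only [sub_zero, smul_eq_mul] at hDh
  have hp := L.analyticAt_weierstrassPExcept 0
  have hq := M.analyticAt_weierstrassPExcept 0
  have hp' := L.analyticAt_derivWeierstrassPExcept 0
  have hq' := M.analyticAt_derivWeierstrassPExcept 0
  -- The difference of the differential equations, multiplied by `z ^ 4` and divided by `z ^ n`:
  -- both sides are now continuous at `0`.
  have key : ∀ᶠ z in 𝓝[≠] (0 : ℂ),
      (n * h z + z * deriv h z) *
        (z ^ 3 * (L.derivWeierstrassPExcept 0 z + M.derivWeierstrassPExcept 0 z) - 4) =
      h z * (4 * ((z ^ 2 * L.weierstrassPExcept 0 z + 1) ^ 2 +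
        (z ^ 2 * L.weierstrassPExcept 0 z + 1) * (z ^ 2 * M.weierstrassPExcept 0 z + 1) +
        (z ^ 2 * M.weierstrassPExcept 0 z + 1) ^ 2) - L.g₂ * z ^ 4) := by
    have e1 := (L.compl_lattice_sdiff_singleton_mem_nhds 0)
    have e2 := (M.compl_lattice_sdiff_singleton_mem_nhds 0)
    filter_upwards [nhdsWithin_le_nhds e1, nhdsWithin_le_nhds e2, self_mem_nhdsWithin,
      nhdsWithin_le_nhds hDh.eventually_nhds, nhdsWithin_le_nhds hh.eventually_analyticAt]
      with z hzL hzM hz hDz hhz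
    have hz0 : z ≠ 0 := hz
    have hzL' : z ∉ L.lattice := fun hmem ↦ hzL ⟨hmem, hz⟩
    have hzM' : z ∉ M.lattice := fun hmem ↦ hzM ⟨hmem, hz⟩
    have dL := L.eqOn_deriv_weierstrassPExcept_derivWeierstrassPExcept 0 hzL
    have dM := M.eqOn_deriv_weierstrassPExcept_derivWeierstrassPExcept 0 hzM
    have aL := (L.analyticOnNhd_weierstrassPExcept 0 z hzL).differentiableAt
    have aM := (M.analyticOnNhd_weierstrassPExcept 0 z hzM).differentiableAt
    have hder : L.derivWeierstrassPExcept 0 z - M.derivWeierstrassPExcept 0 z =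
        n * z ^ (n - 1) * h z + z ^ n * deriv h z := by
      rw [← dL, ← dM, ← deriv_fun_sub aL aM, EventuallyEq.deriv_eq hDz,
        deriv_fun_mul (by fun_prop) hhz.differentiableAt]
      simp
    have hder' : z * (L.derivWeierstrassPExcept 0 z - M.derivWeierstrassPExcept 0 z) =
        z ^ n * (n * h z + z * deriv h z) := by
      rw [hder]
      rcases n with _ | n
      · simp
      · simp only [Nat.add_sub_cancel, pow_succ]
        ring
    have hL := L.derivWeierstrassP_sq z hzL'
    have hM := M.derivWeierstrassP_sq z hzM'
    rw [← L.weierstrassPExcept_add ⟨0, hL0⟩, ← L.derivWeierstrassPExcept_sub ⟨0, hL0⟩] at hL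
    rw [← M.weierstrassPExcept_add ⟨0, hM0⟩, ← M.derivWeierstrassPExcept_sub ⟨0, hM0⟩,
      ← h₂, ← h₃] at hM
    have hDz0 := hDz.self_of_nhds
    simp only [sub_zero] at hL hM
    generalize L.weierstrassPExcept 0 z = p at *
    generalize M.weierstrassPExcept 0 z = q at *
    generalize L.derivWeierstrassPExcept 0 z = p' at *
    generalize M.derivWeierstrassPExcept 0 z = q' at *
    generalize deriv h z = h' at *
    have hzn : z ^ n ≠ 0 := pow_ne_zero _ hz0
    apply mul_left_cancel₀ hzn
    rw [← mul_assoc, ← hder', ← mul_assoc, ← hDz0]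
    clear dL dM hder hder' hDz hDz0
    simp only [ne_eq, OfNat.ofNat_ne_zero, not_false_eq_true, zero_pow, div_zero, sub_zero] at hL hM
    have hLM : z ^ 4 * ((p' - 2 / z ^ 3) ^ 2 - (q' - 2 / z ^ 3) ^ 2) =
        z ^ 4 * (4 * (p + 1 / z ^ 2) ^ 3 - 4 * (q + 1 / z ^ 2) ^ 3 - L.g₂ * (p - q)) := by
      rw [hL, hM]; ring
    have hl : z ^ 4 * ((p' - 2 / z ^ 3) ^ 2 - (q' - 2 / z ^ 3) ^ 2) =
        z * (p' - q') * (z ^ 3 * (p' + q') - 4) := by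
      field_simp
      ring
    have hr : z ^ 4 * (4 * (p + 1 / z ^ 2) ^ 3 - 4 * (q + 1 / z ^ 2) ^ 3 - L.g₂ * (p - q)) =
        (p - q) * (4 * ((z ^ 2 * p + 1) ^ 2 + (z ^ 2 * p + 1) * (z ^ 2 * q + 1) +
          (z ^ 2 * q + 1) ^ 2) - L.g₂ * z ^ 4) := by
      field_simp
      ring
    rw [← hl, hLM, hr]
  have hcont : ∀ f g : ℂ → ℂ, ContinuousAt f 0 → ContinuousAt g 0 →
      (∀ᶠ z in 𝓝[≠] (0 : ℂ), f z = g z) → f 0 = g 0 := fun f g hf hg he ↦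
    tendsto_nhds_unique_of_eventuallyEq (hf.tendsto.mono_left nhdsWithin_le_nhds)
      (hg.tendsto.mono_left nhdsWithin_le_nhds) he
  have h0 := hcont _ _ (by
      have := hp'.continuousAt; have := hq'.continuousAt; have := hh.continuousAt
      have := hh.deriv.continuousAt
      fun_prop) (by
      have := hp.continuousAt; have := hq.continuousAt; have := hh.continuousAt
      fun_prop) key
  simp only [zero_mul, add_zero, weierstrassPExcept_zero] at h0
  have h1 : h 0 * (4 * ((n : ℂ) + 3)) = 0 := by
    linear_combination -h0
  have h2 : (4 * ((n : ℂ) + 3)) ≠ 0 := by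
    exact_mod_cast (by positivity : 4 * (n + 3) ≠ 0)
  exact mul_ne_zero hh0 h2 h1

/-- The local equality at `0` spreads by the identity theorem: the complement of the countable set of
lattice points is connected. -/
theorem weierstrassP_eqOn {L M : PeriodPair} (h₂ : L.g₂ = M.g₂) (h₃ : L.g₃ = M.g₃) :
    Set.EqOn L.weierstrassP M.weierstrassP ((L.lattice : Set ℂ) ∪ M.lattice)ᶜ := by
  have hcount : ((L.lattice : Set ℂ) ∪ M.lattice).Countable := by
    have (L : PeriodPair) : (L.lattice : Set ℂ).Countable := by
      rw [← Set.countable_coe_iff]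
      exact L.latticeEquivProd.injective.countable
    exact (this L).union (this M)
  have hconn : IsPreconnected ((L.lattice : Set ℂ) ∪ M.lattice)ᶜ :=
    (hcount.isPathConnected_compl_of_one_lt_rank (by simp)).isConnected.isPreconnected
  have hev : ∀ᶠ z in 𝓝[≠] (0 : ℂ), z ∈ ((L.lattice : Set ℂ) ∪ M.lattice)ᶜ ∧
      ∀ᶠ w in 𝓝 z, L.weierstrassPExcept 0 w = M.weierstrassPExcept 0 w := by
    filter_upwards [nhdsWithin_le_nhds (L.compl_lattice_sdiff_singleton_mem_nhds 0),
      nhdsWithin_le_nhds (M.compl_lattice_sdiff_singleton_mem_nhds 0), self_mem_nhdsWithin,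
      nhdsWithin_le_nhds (eventually_weierstrassPExcept_eq h₂ h₃).eventually_nhds]
      with z hzL hzM hz hzE
    exact ⟨fun h ↦ h.elim (fun h ↦ hzL ⟨h, hz⟩) (fun h ↦ hzM ⟨h, hz⟩), hzE⟩
  obtain ⟨z₀, hz₀, hE⟩ := hev.exists
  refine AnalyticOnNhd.eqOn_of_preconnected_of_eventuallyEq
    (L.analyticOnNhd_weierstrassP.mono fun z hz h ↦ hz (Or.inl h))
    (M.analyticOnNhd_weierstrassP.mono fun z hz h ↦ hz (Or.inr h)) hconn hz₀ ?_
  filter_upwards [hE] with w hw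
  rw [← L.weierstrassPExcept_add ⟨0, zero_mem _⟩, ← M.weierstrassPExcept_add ⟨0, zero_mem _⟩, hw]

/-- Lattice points are recognised as the poles of `℘`. -/
theorem lattice_le_of_g₂_eq_of_g₃_eq {L M : PeriodPair} (h₂ : L.g₂ = M.g₂) (h₃ : L.g₃ = M.g₃) :
    L.lattice ≤ M.lattice := by
  intro l hl
  by_contra hlM
  have hev : L.weierstrassP =ᶠ[𝓝[≠] l] M.weierstrassP := by
    filter_upwards [nhdsWithin_le_nhds (L.compl_lattice_sdiff_singleton_mem_nhds l),
      nhdsWithin_le_nhds (M.isClosed_lattice.isOpen_compl.mem_nhds hlM), self_mem_nhdsWithin]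
      with z hzL hzM hz
    exact weierstrassP_eqOn h₂ h₃ fun h ↦ h.elim (fun h ↦ hzL ⟨h, hz⟩) hzM
  have h1 := L.order_weierstrassP l hl
  rw [meromorphicOrderAt_congr hev] at h1
  have h2 := (M.analyticOnNhd_weierstrassP l hlM).meromorphicOrderAt_nonneg
  rw [h1] at h2
  exact absurd h2 (by decide)

/-- Two lattices with the same invariants `g₂` and `g₃` are equal. -/
theorem lattice_eq_of_g₂_eq_of_g₃_eq {L M : PeriodPair} (h₂ : L.g₂ = M.g₂) (h₃ : L.g₃ = M.g₃) :
    L.lattice = M.lattice :=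
  le_antisymm (lattice_le_of_g₂_eq_of_g₃_eq h₂ h₃) (lattice_le_of_g₂_eq_of_g₃_eq h₂.symm h₃.symm)

end PeriodPair

end Lattice

/-! ### Eisenstein series separate lattices -/

section Separation

open MatrixGroups

/-- The period pair `(k z, k)`, whose lattice is `k (ℤ z + ℤ)`. -/
noncomputable def scaledPeriodPair (z : ℍ) (k : ℂˣ) : PeriodPair where
  ω₁ := k * z
  ω₂ := k
  indep := by
    rw [LinearIndependent.pair_iff]
    intro s t h
    simp only [Complex.real_smul] at h
    have h' : (s : ℂ) * z + t = 0 := by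
      apply mul_left_cancel₀ k.ne_zero
      linear_combination h
    have hs : s = 0 := by
      have := congrArg Complex.im h'
      simpa [z.im_ne_zero] using this
    subst hs
    simpa using h'

theorem scaledPeriodPair_G (z : ℍ) (k : ℂˣ) {n : ℕ} (hn : 3 ≤ n) :
    (scaledPeriodPair z k).G n =
      (k : ℂ)⁻¹ ^ n * (2 * riemannZeta n * ModularForm.E hn z) := by
  have hE : ModularForm.E hn z = 1 / 2 * eisensteinSeries (N := 1) 0 n z := by
    rw [show ModularForm.E hn z =
        (1 / 2 : ℂ) • EisensteinSeries.eisensteinSeriesSIF (N := 1) 0 n z from rfl,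
      EisensteinSeries.eisensteinSeriesSIF_apply 0 n z, smul_eq_mul]
  have h := tsum_eisSummand_eq_riemannZeta_mul_eisensteinSeries hn z
  rw [hE, show 2 * riemannZeta n * (1 / 2 * eisensteinSeries (N := 1) 0 n z) =
    riemannZeta n * eisensteinSeries (N := 1) 0 n z by ring, ← h, PeriodPair.G, ← tsum_mul_left,
    ← (scaledPeriodPair z k).latticeEquivProd.symm.toEquiv.tsum_eq,
    ← (finTwoArrowEquiv ℤ).symm.tsum_eq]
  refine tsum_congr fun x ↦ ?_
  have := (scaledPeriodPair z k).latticeEquiv_symm_apply x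
  simp only [LinearEquiv.coe_toEquiv, this]
  simp only [scaledPeriodPair, EisensteinSeries.eisSummand, finTwoArrowEquiv_symm_apply,
    Matrix.cons_val_zero, Matrix.cons_val_one, zpow_neg, zpow_natCast]
  rw [inv_pow, ← mul_inv, ← mul_pow]
  ring_nf

/-- If `ℤ z + ℤ` and `ℤ w + ℤ` agree up to scaling, then `z` and `w` are related by a modular
transformation, and the scaling factor is its denominator. -/
theorem exists_smul_of_lattice_eq {z w : ℍ} {k κ : ℂˣ}
    (h : (scaledPeriodPair z k).lattice = (scaledPeriodPair w κ).lattice) :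
    ∃ γ : SL(2, ℤ), w = γ • z ∧ (κ : ℂ) = k * UpperHalfPlane.denom γ z := by
  obtain ⟨a, b, hab⟩ := PeriodPair.mem_lattice.mp (h ▸ (scaledPeriodPair w κ).ω₁_mem_lattice)
  obtain ⟨c, d, hcd⟩ := PeriodPair.mem_lattice.mp (h ▸ (scaledPeriodPair w κ).ω₂_mem_lattice)
  obtain ⟨a', b', hab'⟩ := PeriodPair.mem_lattice.mp (h ▸ (scaledPeriodPair z k).ω₁_mem_lattice)
  obtain ⟨c', d', hcd'⟩ := PeriodPair.mem_lattice.mp (h ▸ (scaledPeriodPair z k).ω₂_mem_lattice)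
  have hind : ∀ s t : ℤ, (s : ℂ) * (k * z) + t * k = 0 → s = 0 ∧ t = 0 := by
    intro s t hst
    have := LinearIndependent.pair_iff.mp (scaledPeriodPair z k).indep s t (by
      simpa [scaledPeriodPair] using hst)
    exact_mod_cast this
  simp only [scaledPeriodPair] at hab hcd hab' hcd'
  have hdet : (a' * d' - b' * c') * (a * d - b * c) = 1 := by
    obtain ⟨h1, h2⟩ := hind (a' * a + b' * c - 1) (a' * b + b' * d) (by
      push_cast; linear_combination hab' + a' * hab + b' * hcd)
    obtain ⟨h3, h4⟩ := hind (c' * a + d' * c) (c' * b + d' * d - 1) (by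
      push_cast; linear_combination hcd' + c' * hab + d' * hcd)
    linear_combination (c' * b + d' * d) * h1 + h4 - h2 * (c' * a + d' * c)
  have hκ : (κ : ℂ) = k * (c * z + d) := by linear_combination -hcd
  have hw : (w : ℂ) * (c * z + d) = a * z + b := by
    apply mul_left_cancel₀ k.ne_zero
    linear_combination -hab - w * hκ
  have hne : (c * z + d : ℂ) ≠ 0 := fun h0 ↦ κ.ne_zero (by rw [hκ, h0, mul_zero])
  have him : (a * d - b * c : ℝ) * z.im = w.im * Complex.normSq (c * z + d) := by
    have h1 := congrArg Complex.re hw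
    have h2 := congrArg Complex.im hw
    simp [Complex.normSq_apply] at h1 h2 ⊢
    linear_combination c * z.im * h1 - ((c : ℝ) * z.re + d) * h2
  have hpos : 0 < a * d - b * c := by
    have h1 : 0 < (a * d - b * c : ℝ) * z.im := by
      rw [him]; exact mul_pos w.im_pos (Complex.normSq_pos.mpr hne)
    exact_mod_cast (pos_iff_pos_of_mul_pos h1).mpr z.im_pos
  have hdet1 : a * d - b * c = 1 := by
    rcases Int.isUnit_iff.mp (IsUnit.of_mul_eq_one_right _ hdet) with h | h <;> omega
  obtain ⟨γ, hγ⟩ : ∃ γ : SL(2, ℤ), γ.1 = !![a, b; c, d] :=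
    ⟨⟨!![a, b; c, d], by rw [Matrix.det_fin_two_of, hdet1]⟩, rfl⟩
  refine ⟨γ, ?_, ?_⟩
  · apply UpperHalfPlane.ext
    rw [UpperHalfPlane.specialLinearGroup_apply]
    simp [hγ, eq_div_iff hne, hw]
  · rw [ModularGroup.denom_apply, hγ]
    simpa using hκ

/-- The values `(g₂(z) k⁻⁴, g₃(z) k⁻⁶)` determine the pair `(z, k)` up to the modular group. -/
theorem exists_smul_of_eisG_eq {z w : ℍ} {k κ : ℂˣ}
    (h2 : eisG2 z * (k : ℂ)⁻¹ ^ 4 = eisG2 w * (κ : ℂ)⁻¹ ^ 4)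
    (h3 : eisG3 z * (k : ℂ)⁻¹ ^ 6 = eisG3 w * (κ : ℂ)⁻¹ ^ 6) :
    ∃ γ : SL(2, ℤ), w = γ • z ∧ (κ : ℂ) = k * UpperHalfPlane.denom γ z := by
  have hpi : (Real.pi : ℂ) ≠ 0 := by exact_mod_cast Real.pi_ne_zero
  apply exists_smul_of_lattice_eq
  apply PeriodPair.lattice_eq_of_g₂_eq_of_g₃_eq
  · rw [eisG2_eq, eisG2_eq] at h2
    have : (k : ℂ)⁻¹ ^ 4 * ModularForm.E₄ z = (κ : ℂ)⁻¹ ^ 4 * ModularForm.E₄ w := by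
      apply mul_left_cancel₀ (show -((Real.pi : ℂ) ^ 2 / 3) ≠ 0 by simp [hpi])
      linear_combination h2
    rw [PeriodPair.g₂, PeriodPair.g₂, scaledPeriodPair_G z k (n := 4) (by norm_num),
      scaledPeriodPair_G w κ (n := 4) (by norm_num)]
    linear_combination (120 * riemannZeta 4) * this
  · rw [eisG3_eq, eisG3_eq] at h3
    have : (k : ℂ)⁻¹ ^ 6 * ModularForm.E₆ z = (κ : ℂ)⁻¹ ^ 6 * ModularForm.E₆ w := by
      apply mul_left_cancel₀ (show -(Complex.I * (Real.pi : ℂ) ^ 3 / 27) ≠ 0 by simp [hpi])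
      linear_combination h3
    rw [PeriodPair.g₃, PeriodPair.g₃, scaledPeriodPair_G z k (n := 6) (by norm_num),
      scaledPeriodPair_G w κ (n := 6) (by norm_num)]
    linear_combination (280 * riemannZeta 6) * this

end Separation

/-! ### Behaviour at the cusp, and the Wronskian of the Eisenstein series -/

section Cusp

open MatrixGroups Filter Topology UpperHalfPlane ModularForm Derivative
open scoped Manifold

/-- The normalised Eisenstein series tend to `1` at the cusp. -/
theorem tendsto_E_atImInfty {k : ℕ} (hk : 3 ≤ k) (hk2 : Even k) :
    Tendsto (ModularForm.E hk) atImInfty (𝓝 1) := by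
  have hper := SlashInvariantFormClass.periodic_comp_ofComplex (ModularForm.E hk)
    one_mem_strictPeriods_SL
  have hv : valueAtInfty (ModularForm.E hk) = 1 := by
    rw [← EisensteinSeries.E_qExpansion_coeff_zero hk hk2, qExpansion_coeff_zero one_pos
      (ModularFormClass.analyticAt_cuspFunction_zero _ one_pos one_mem_strictPeriods_SL) hper]
  have hO := exp_decay_sub_atImInfty one_pos hper (ModularFormClass.holo (ModularForm.E hk))
    (ModularFormClass.bdd_at_infty (ModularForm.E hk))
  rw [hv] at hO
  have him : Tendsto (fun τ : ℍ ↦ Real.exp (-2 * Real.pi * τ.im / 1)) atImInfty (𝓝 0) := by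
    refine Real.tendsto_exp_atBot.comp ?_
    have : Tendsto UpperHalfPlane.im atImInfty atTop := tendsto_comap
    simpa using this.const_mul_atTop_of_neg (r := -2 * Real.pi) (by
      have := Real.pi_pos; linarith)
  exact tendsto_sub_nhds_zero_iff.mp (hO.trans_tendsto him)

/-- By Cauchy's estimate, the derivative of a holomorphic function with a limit at the cusp
vanishes at the cusp. -/
theorem isZeroAtImInfty_normalizedDeriv {f : ℍ → ℂ} {c : ℂ} (hf : MDiff f)
    (hc : Tendsto f atImInfty (𝓝 c)) :
    IsZeroAtImInfty (normalizedDerivOfComplex f) := by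
  rw [isZeroAtImInfty_iff]
  intro ε hε
  obtain ⟨A, hA⟩ := (atImInfty_mem _).mp (hc (Metric.closedBall_mem_nhds c
    (ε := ε * ‖(2 * Real.pi * Complex.I : ℂ)‖) (mul_pos hε (by simp [Real.pi_ne_zero]))))
  refine ⟨max A 1 + 1, fun z hz ↦ ?_⟩
  have hball : ∀ w ∈ Metric.closedBall (z : ℂ) 1, max A 1 ≤ w.im := by
    intro w hw
    have h1 := (Complex.abs_im_le_norm (w - z)).trans (by simpa [dist_eq_norm] using hw)
    rw [abs_le] at h1
    have : (w - z).im = w.im - z.im := by simp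
    linarith
  rw [mdifferentiable_iff] at hf
  have hd : DiffContOnCl ℂ (fun w ↦ (f ∘ ofComplex) w - c) (Metric.ball (z : ℂ) 1) :=
    (hf.sub_const c).diffContOnCl_ball fun w hw ↦
      lt_of_lt_of_le one_pos ((le_max_right A 1).trans (hball w hw))
  have := Complex.norm_deriv_le_of_forall_mem_sphere_norm_le one_pos hd
    (C := ε * ‖(2 * Real.pi * Complex.I : ℂ)‖) (fun w hw ↦ ?_)
  · rw [deriv_sub_const] at this
    rw [normalizedDerivOfComplex, norm_mul, norm_inv, inv_mul_le_iff₀ (by simp [Real.pi_ne_zero])]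
    linarith
  · have hwim := hball w (Metric.sphere_subset_closedBall hw)
    have hw0 : 0 < w.im := lt_of_lt_of_le one_pos ((le_max_right A 1).trans hwim)
    have := hA (ofComplex w) (by
      rw [ofComplex_apply_of_im_pos hw0]; exact (le_max_left A 1).trans hwim)
    simpa [dist_eq_norm] using this

/-- The Wronskian `2 E₄ D E₆ - 3 E₆ D E₄`, written with Serre derivatives, in which the
quasi-modular contributions of `E₂` cancel. -/
noncomputable def eisensteinWronskianFun : ℍ → ℂ :=
  (2 : ℂ) • (⇑E₄ * serreDerivative 6 E₆) - (3 : ℂ) • (⇑E₆ * serreDerivative 4 E₄)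

theorem eisensteinWronskianFun_apply (z : ℍ) :
    eisensteinWronskianFun z = 2 * (E₄ z * normalizedDerivOfComplex E₆ z) -
      3 * (E₆ z * normalizedDerivOfComplex E₄ z) := by
  simp only [eisensteinWronskianFun, Pi.sub_apply, Pi.smul_apply, Pi.mul_apply,
    serreDerivative_apply, smul_eq_mul]
  ring

theorem eisensteinWronskianFun_slash (γ : SL(2, ℤ)) :
    eisensteinWronskianFun ∣[(12 : ℤ)] γ = eisensteinWronskianFun := by
  have h4 : ⇑E₄ ∣[(4 : ℤ)] γ = ⇑E₄ := SlashInvariantForm.slash_action_eqn E₄ γ ⟨γ, rfl⟩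
  have h6 : ⇑E₆ ∣[(6 : ℤ)] γ = ⇑E₆ := SlashInvariantForm.slash_action_eqn E₆ γ ⟨γ, rfl⟩
  have d4 := serreDerivative_slash_invariant (ModularFormClass.holo E₄) h4
  have d6 := serreDerivative_slash_invariant (ModularFormClass.holo E₆) h6
  have m1 := mul_slash_SL2 4 (6 + 2) γ E₄ (serreDerivative (6 : ℤ) E₆)
  have m2 := mul_slash_SL2 6 (4 + 2) γ E₆ (serreDerivative (4 : ℤ) E₄)
  rw [h4, d6] at m1
  rw [h6, d4] at m2
  push_cast at m1 m2
  rw [eisensteinWronskianFun, sub_eq_add_neg, SlashAction.add_slash, SlashAction.neg_slash,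
    SL_smul_slash, SL_smul_slash, m1, m2]

/-- The Wronskian of `E₄` and `E₆` is a cusp form of weight `12`. -/
noncomputable def eisensteinWronskian : CuspForm 𝒮ℒ 12 where
  toFun := eisensteinWronskianFun
  slash_action_eq' A hA := by
    obtain ⟨γ, rfl⟩ := hA
    exact eisensteinWronskianFun_slash γ
  holo' := by
    have h4 := ModularFormClass.holo E₄
    have h6 := ModularFormClass.holo E₆
    exact ((h4.mul (serreDerivative_mdifferentiable 6 h6)).const_smul 2).sub
      ((h6.mul (serreDerivative_mdifferentiable 4 h4)).const_smul 3)
  zero_at_cusps' hc := by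
    rw [Subgroup.IsArithmetic.isCusp_iff_isCusp_SL2Z] at hc
    rw [OnePoint.isZeroAt_iff_forall_SL2Z hc]
    intro γ _
    rw [eisensteinWronskianFun_slash]
    have t4 := tendsto_E_atImInfty (k := 4) (by norm_num) ⟨2, rfl⟩
    have t6 := tendsto_E_atImInfty (k := 6) (by norm_num) ⟨3, rfl⟩
    have d4 := isZeroAtImInfty_normalizedDeriv (ModularFormClass.holo E₄) t4
    have d6 := isZeroAtImInfty_normalizedDeriv (ModularFormClass.holo E₆) t6
    have := ((t4.mul d6).const_mul 2).sub ((t6.mul d4).const_mul 3)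
    simp only [mul_zero, sub_zero] at this
    exact this.congr fun z ↦ (eisensteinWronskianFun_apply z).symm

/-- The function `E₄³ / Δ`, the modular invariant. -/
noncomputable def modularInvariant (z : ℍ) : ℂ := E₄ z ^ 3 / discriminant z

theorem tendsto_norm_modularInvariant :
    Tendsto (fun z ↦ ‖modularInvariant z‖) atImInfty atTop := by
  have t4 := ((tendsto_E_atImInfty (k := 4) (by norm_num) ⟨2, rfl⟩).pow 3).norm
  have hΔ : Tendsto (fun z ↦ ‖discriminant z‖) atImInfty (𝓝[>] 0) := by
    refine tendsto_nhdsWithin_iff.mpr ⟨?_, .of_forall fun z ↦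
      norm_pos_iff.mpr (discriminant_ne_zero z)⟩
    simpa using discriminant_isZeroAtImInfty.norm
  have := t4.pos_mul_atTop (by simp) (tendsto_inv_nhdsGT_zero.comp hΔ)
  refine this.congr fun z ↦ ?_
  simp [modularInvariant, div_eq_mul_inv]

theorem modularInvariant_not_const (c : ℂ) : ¬ ∀ z, modularInvariant z = c := by
  intro h
  have := tendsto_norm_modularInvariant
  simp only [h] at this
  exact not_tendsto_const_atTop _ _ this

theorem differentiableOn_modularInvariant :
    DifferentiableOn ℂ (modularInvariant ∘ ofComplex) upperHalfPlaneSet := by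
  have h4 := UpperHalfPlane.mdifferentiable_iff.mp (ModularFormClass.holo E₄)
  have hΔ := UpperHalfPlane.mdifferentiable_iff.mp (CuspFormClass.holo CuspForm.discriminant)
  exact (h4.pow 3).div hΔ fun z _ ↦ discriminant_ne_zero _

/-- The Wronskian of `E₄` and `E₆` is a nonzero multiple of `Δ`: otherwise it would vanish
identically, and `E₄³ / Δ` would be constant. -/
theorem eisensteinWronskian_ne_zero (z : ℍ) : eisensteinWronskian z ≠ 0 := by
  obtain ⟨c, hc⟩ := CuspForm.exists_smul_discriminant_of_weight_eq_twelve eisensteinWronskian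
  have hcz (z : ℍ) : c * discriminant z = eisensteinWronskian z := congrArg (· z) hc
  rw [← hcz]
  refine mul_ne_zero (fun hc0 ↦ ?_) (discriminant_ne_zero z)
  subst hc0
  have hW (z : ℍ) : 2 * (E₄ z * normalizedDerivOfComplex E₆ z) -
      3 * (E₆ z * normalizedDerivOfComplex E₄ z) = 0 := by
    rw [← eisensteinWronskianFun_apply]
    exact (hcz z).symm.trans (zero_mul _)
  have hconn : IsPreconnected upperHalfPlaneSet :=
    (Convex.isPreconnected (convex_halfSpace_im_gt 0))
  have hderiv : upperHalfPlaneSet.EqOn (deriv (modularInvariant ∘ ofComplex)) 0 := by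
    intro w hw
    have h4 := ((UpperHalfPlane.mdifferentiable_iff.mp (ModularFormClass.holo E₄)).differentiableAt
      (isOpen_upperHalfPlaneSet.mem_nhds hw)).hasDerivAt
    have h6 := ((UpperHalfPlane.mdifferentiable_iff.mp (ModularFormClass.holo E₆)).differentiableAt
      (isOpen_upperHalfPlaneSet.mem_nhds hw)).hasDerivAt
    have hΔ (w : ℂ) : discriminant (ofComplex w) =
        ((E₄ ∘ ofComplex) w ^ 3 - (E₆ ∘ ofComplex) w ^ 2) / 1728 :=
      discriminant_eq_E₄_cube_sub_E₆_sq _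
    have hne : ((E₄ ∘ ofComplex) w ^ 3 - (E₆ ∘ ofComplex) w ^ 2) / 1728 ≠ 0 :=
      hΔ w ▸ discriminant_ne_zero _
    have hj : modularInvariant ∘ ofComplex = fun w ↦ (E₄ ∘ ofComplex) w ^ 3 /
        (((E₄ ∘ ofComplex) w ^ 3 - (E₆ ∘ ofComplex) w ^ 2) / 1728) := by
      funext w
      rw [← hΔ]
      rfl
    have hd := (h4.pow 3).div (((h4.pow 3).sub (h6.pow 2)).div_const 1728) hne
    have hWw := hW (ofComplex w)
    have hwof : ((ofComplex w : ℍ) : ℂ) = w := by rw [ofComplex_apply_of_im_pos hw]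
    simp only [normalizedDerivOfComplex, hwof] at hWw
    rw [hj]
    refine hd.deriv.trans ?_
    have hpi : (2 * Real.pi * Complex.I : ℂ) ≠ 0 := by simp [Real.pi_ne_zero]
    have h0 : 2 * (E₄ (ofComplex w) * deriv (⇑E₆ ∘ ofComplex) w) -
        3 * (E₆ (ofComplex w) * deriv (⇑E₄ ∘ ofComplex) w) = 0 := by
      apply (mul_eq_zero_iff_left (inv_ne_zero hpi)).mp
      linear_combination hWw
    rw [Pi.zero_apply, div_eq_zero_iff]
    left
    simp only [Function.comp_apply, Pi.pow_apply, Pi.sub_apply]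
    push_cast
    linear_combination (E₄ (ofComplex w) ^ 2 * E₆ (ofComplex w) / 1728) * h0
  refine modularInvariant_not_const (modularInvariant (ofComplex I)) fun w ↦ ?_
  simpa using isOpen_upperHalfPlaneSet.is_const_of_deriv_eq_zero hconn
    differentiableOn_modularInvariant hderiv w.im_pos I.im_pos

end Cusp

/-! ### Surjectivity of the modular invariant -/

section Surjectivity

open MatrixGroups Filter Topology UpperHalfPlane ModularForm

theorem modularInvariant_smul (γ : SL(2, ℤ)) (z : ℍ) :
    modularInvariant (γ • z) = modularInvariant z := by
  have h4 := levelOne_smul (k := 4) E₄ γ z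
  have h6 := levelOne_smul (k := 6) E₆ γ z
  have hd := UpperHalfPlane.denom_ne_zero γ z
  have hne := discriminant_ne_zero z
  simp only [modularInvariant, discriminant_eq_E₄_cube_sub_E₆_sq, h4, h6] at hne ⊢
  rw [show ((denom γ z ^ 4 * E₄ z) ^ 3 - (denom γ z ^ 6 * E₆ z) ^ 2) / 1728 =
    denom γ z ^ 12 * ((E₄ z ^ 3 - E₆ z ^ 2) / 1728) by ring, mul_pow, ← pow_mul,
    mul_div_mul_left _ _ (pow_ne_zero _ hd)]

theorem isOpen_range_modularInvariant : IsOpen (Set.range modularInvariant) := by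
  have hconn : IsPreconnected upperHalfPlaneSet :=
    (Convex.isPreconnected (convex_halfSpace_im_gt 0))
  have han := differentiableOn_modularInvariant.analyticOnNhd isOpen_upperHalfPlaneSet
  rcases han.is_constant_or_isOpen hconn with ⟨c, hc⟩ | h
  · exact absurd (fun z ↦ by simpa using hc z z.im_pos) (modularInvariant_not_const c)
  · convert h _ subset_rfl isOpen_upperHalfPlaneSet
    ext c
    constructor
    · rintro ⟨z, rfl⟩
      exact ⟨z, z.im_pos, by simp⟩
    · rintro ⟨z, -, rfl⟩
      exact ⟨ofComplex z, rfl⟩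

theorem continuous_modularInvariant : Continuous modularInvariant := by
  have h4 := (ModularFormClass.holo E₄).continuous
  have hΔ := (CuspFormClass.holo CuspForm.discriminant).continuous
  exact (h4.pow 3).div hΔ discriminant_ne_zero

/-- The modular invariant is proper modulo the modular group, hence its range is closed. -/
theorem isClosed_range_modularInvariant : IsClosed (Set.range modularInvariant) := by
  refine isClosed_of_closure_subset fun c hc ↦ ?_
  obtain ⟨A, hA⟩ := (atImInfty_mem _).mp
    (tendsto_norm_modularInvariant.eventually_gt_atTop (‖c‖ + 1))
  have hK : IsClosed (modularInvariant '' ModularGroup.truncatedFundamentalDomain A) :=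
    ((ModularGroup.isCompact_truncatedFundamentalDomain A).image
      continuous_modularInvariant).isClosed
  refine Set.image_subset_range _ _ (hK.closure_subset (mem_closure_iff_frequently.mpr ?_))
  refine ((mem_closure_iff_frequently.mp hc).and_eventually
    (Metric.ball_mem_nhds c one_pos)).mono ?_
  rintro _ ⟨⟨z, rfl⟩, hz⟩
  obtain ⟨γ, hγ⟩ := ModularGroup.exists_smul_mem_fd z
  refine ⟨γ • z, ⟨hγ, ?_⟩, modularInvariant_smul γ z⟩
  by_contra! him
  have h1 : ‖c‖ + 1 < ‖modularInvariant (γ • z)‖ := hA _ him.le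
  rw [modularInvariant_smul] at h1
  have h2 := norm_le_norm_add_norm_sub' (modularInvariant z) c
  have h3 : ‖modularInvariant z - c‖ < 1 := by simpa [dist_eq_norm] using hz
  linarith

theorem modularInvariant_surjective : Function.Surjective modularInvariant :=
  Set.range_eq_univ.mp (IsClopen.eq_univ
    ⟨isClosed_range_modularInvariant, isOpen_range_modularInvariant⟩ (Set.range_nonempty _))

/-- Every pair `(t₂, t₃)` with `27 t₃² ≠ t₂³` has the form `(g₂(z) k⁻⁴, g₃(z) k⁻⁶)`. -/
theorem exists_eisG_eq (t : regularLocus) :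
    ∃ (z : ℍ) (k : ℂˣ), t.1.2.1 = eisG2 z * (k : ℂ)⁻¹ ^ 4 ∧
      t.1.2.2 = eisG3 z * (k : ℂ)⁻¹ ^ 6 := by
  obtain ⟨⟨t₁, t₂, t₃⟩, ht⟩ := t
  change 27 * t₃ ^ 2 - t₂ ^ 3 ≠ 0 at ht
  have hpi : (Real.pi : ℂ) ≠ 0 := by exact_mod_cast Real.pi_ne_zero
  -- `1728 g₂³ / (g₂³ - 27 g₃²)` is the modular invariant
  obtain ⟨z, hz⟩ := modularInvariant_surjective (1728 * t₂ ^ 3 / (t₂ ^ 3 - 27 * t₃ ^ 2))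
  have ht' : t₂ ^ 3 - 27 * t₃ ^ 2 ≠ 0 := fun h ↦ ht (by linear_combination -h)
  have hd : 27 * eisG3 z ^ 2 - eisG2 z ^ 3 ≠ 0 := eisMap_mem_regularLocus z
  have hcross : eisG2 z ^ 3 * t₃ ^ 2 = t₂ ^ 3 * eisG3 z ^ 2 := by
    have hΔ := discr_eisMap z
    have hE : 27 * eisG2 z ^ 3 = -(Real.pi : ℂ) ^ 6 * E₄ z ^ 3 := by rw [eisG2_eq]; ring
    rw [modularInvariant, div_eq_div_iff (discriminant_ne_zero z) ht'] at hz
    have : 729 * (eisG2 z ^ 3 * t₃ ^ 2 - t₂ ^ 3 * eisG3 z ^ 2) = 0 := by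
      linear_combination -(t₂ ^ 3 - 27 * t₃ ^ 2) * hE - 27 * t₂ ^ 3 * hΔ + Real.pi ^ 6 * hz
    exact sub_eq_zero.mp (by simpa using this)
  suffices ∃ k : ℂ, k ≠ 0 ∧ t₂ * k ^ 4 = eisG2 z ∧ t₃ * k ^ 6 = eisG3 z by
    obtain ⟨k, hk, h2, h3⟩ := this
    refine ⟨z, Units.mk0 k hk, ?_, ?_⟩
    · rw [Units.val_mk0, ← h2]; field_simp
    · rw [Units.val_mk0, ← h3]; field_simp
  by_cases h2 : t₂ = 0
  · have h3 : t₃ ≠ 0 := by rintro rfl; simp [h2] at ht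
    have hg2 : eisG2 z = 0 := by simpa [h2, h3] using hcross
    have hg3 : eisG3 z ≠ 0 := fun h ↦ by simp [hg2, h] at hd
    obtain ⟨k, hk⟩ := IsAlgClosed.exists_pow_nat_eq (eisG3 z / t₃) (n := 6) (by norm_num)
    refine ⟨k, ?_, by simp [h2, hg2], by rw [hk]; field_simp⟩
    rintro rfl
    exact div_ne_zero hg3 h3 (by rw [← hk]; norm_num)
  · have hg2 : eisG2 z ≠ 0 := by
      intro h
      have hg3 : eisG3 z = 0 := by simpa [h, h2] using hcross
      simp [h, hg3] at hd
    obtain ⟨k, hk⟩ := IsAlgClosed.exists_pow_nat_eq (eisG2 z / t₂) (n := 4) (by norm_num)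
    have hk0 : k ≠ 0 := by
      rintro rfl
      exact div_ne_zero hg2 h2 (by rw [← hk]; norm_num)
    have hk4 : t₂ * k ^ 4 = eisG2 z := by rw [hk]; field_simp
    have hsq : (t₃ * k ^ 6) ^ 2 = eisG3 z ^ 2 := by
      apply mul_left_cancel₀ (pow_ne_zero 3 h2)
      rw [← hcross, ← hk4]
      ring
    rcases sq_eq_sq_iff_eq_or_eq_neg.mp hsq with h | h
    · exact ⟨k, hk0, hk4, h⟩
    · -- multiplying `k` by `i` preserves `k⁴` and changes the sign of `k⁶`
      refine ⟨Complex.I * k, mul_ne_zero Complex.I_ne_zero hk0, ?_, ?_⟩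
      · rw [mul_pow, Complex.I_pow_four, one_mul, hk4]
      · rw [mul_pow, show Complex.I ^ 6 = -1 by
          rw [show 6 = 2 * 3 by rfl, pow_mul, Complex.I_sq]; norm_num]
        linear_combination -h

end Surjectivity

/-! ### Period matrices and the Hermitian pairing of their columns -/

section Periods

open MatrixGroups UpperHalfPlane

/-- The imaginary part of `x₁ * conj x₂`; on the pair of periods of a lattice this is its covolume
(up to sign). -/
noncomputable def areaForm (x : ℂ × ℂ) : ℝ := (x.1 * conj x.2).im

/-- The skew-Hermitian pairing `x₁ * conj y₂ - x₂ * conj y₁` on `ℂ²`, which is invariant under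
real matrices of determinant one. -/
noncomputable def skewPairing (x y : ℂ × ℂ) : ℂ := x.1 * conj y.2 - x.2 * conj y.1

theorem skewPairing_self (x : ℂ × ℂ) : skewPairing x x = 2 * Complex.I * areaForm x := by
  apply Complex.ext <;> simp [skewPairing, areaForm] <;> ring

theorem areaForm_smul (a : ℂ) (x : ℂ × ℂ) : areaForm (a • x) = areaForm x * ‖a‖ ^ 2 := by
  rw [Complex.sq_norm, Complex.normSq_apply]
  simp [areaForm]
  ring

theorem areaForm_smul_add_smul (a b : ℂ) (x y : ℂ × ℂ) :
    areaForm (a • x + b • y) = areaForm x * ‖a‖ ^ 2 + areaForm y * ‖b‖ ^ 2 +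
      (skewPairing x y * a * conj b).im := by
  rw [Complex.sq_norm, Complex.normSq_apply, Complex.sq_norm, Complex.normSq_apply]
  simp [areaForm, skewPairing]
  ring

theorem skewPairing_smul_smul_add_smul (a b c : ℂ) (x y : ℂ × ℂ) :
    skewPairing (a • x) (b • x + c • y) =
      skewPairing x y * a * conj c + 2 * Complex.I * a * conj b * areaForm x := by
  have h := skewPairing_self x
  simp only [skewPairing, Prod.smul_fst, Prod.smul_snd, Prod.fst_add, Prod.snd_add, smul_eq_mul,
    map_add, map_mul] at h ⊢
  linear_combination (a * conj b) * h

theorem norm_skewPairing_sq (x y : ℂ × ℂ) :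
    ‖skewPairing x y‖ ^ 2 =
      4 * areaForm x * areaForm y + ‖x.1 * y.2 - x.2 * y.1‖ ^ 2 := by
  rw [Complex.sq_norm, Complex.normSq_apply, Complex.sq_norm, Complex.normSq_apply]
  simp [areaForm, skewPairing]
  ring

theorem areaForm_of_det_eq_one {a b c d : ℤ} (h : a * d - b * c = 1) (x : ℂ × ℂ) :
    areaForm (a * x.1 + b * x.2, c * x.1 + d * x.2) = areaForm x := by
  have h' : (a * d - b * c : ℝ) = 1 := by exact_mod_cast h
  simp [areaForm]
  linear_combination (x.1.im * x.2.re - x.1.re * x.2.im) * h'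

theorem skewPairing_of_det_eq_one {a b c d : ℤ} (h : a * d - b * c = 1) (x y : ℂ × ℂ) :
    skewPairing (a * x.1 + b * x.2, c * x.1 + d * x.2) (a * y.1 + b * y.2, c * y.1 + d * y.2) =
      skewPairing x y := by
  have h' : (a * d - b * c : ℂ) = 1 := by exact_mod_cast h
  simp [skewPairing]
  linear_combination (x.1 * conj y.2 - x.2 * conj y.1) * h'

/-- The first column `(k z, k)`, with `u = k⁻¹`, of the period matrix. -/
noncomputable def firstPeriods (z u : ℂ) : ℂ × ℂ := (u⁻¹ * z, u⁻¹)

/-- The second column `(z k' - k⁻¹, k')` of the period matrix, with `u = k⁻¹` and with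
`k' = k t₁ - k⁻¹ g₁(z)` the solution of `t₁ = g₁(z) k⁻² + k' k⁻¹`. -/
noncomputable def secondPeriods (z u t₁ : ℂ) : ℂ × ℂ :=
  (z * (u⁻¹ * t₁ - eisG1 (ofComplex z) * u) - u, u⁻¹ * t₁ - eisG1 (ofComplex z) * u)

theorem det_periods (z t₁ : ℂ) {u : ℂ} (hu : u ≠ 0) :
    (firstPeriods z u).1 * (secondPeriods z u t₁).2 -
      (firstPeriods z u).2 * (secondPeriods z u t₁).1 = 1 := by
  simp only [firstPeriods, secondPeriods]
  field_simp
  ring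

/-- Pairs `(z, u)` with the same values `(g₂(z) u⁴, g₃(z) u⁶)` have period matrices which differ by
left multiplication by an element of `SL(2, ℤ)`. -/
theorem exists_periods_eq {z w : ℍ} {u v : ℂ} (hu : u ≠ 0) (hv : v ≠ 0)
    (h2 : eisG2 z * u ^ 4 = eisG2 w * v ^ 4) (h3 : eisG3 z * u ^ 6 = eisG3 w * v ^ 6) :
    ∃ a b c d : ℤ, a * d - b * c = 1 ∧
      (firstPeriods w v = (a * (firstPeriods z u).1 + b * (firstPeriods z u).2,
        c * (firstPeriods z u).1 + d * (firstPeriods z u).2)) ∧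
      ∀ t₁, secondPeriods w v t₁ =
        (a * (secondPeriods z u t₁).1 + b * (secondPeriods z u t₁).2,
          c * (secondPeriods z u t₁).1 + d * (secondPeriods z u t₁).2) := by
  obtain ⟨γ, rfl, hγ⟩ := exists_smul_of_eisG_eq (z := z) (w := w)
    (k := Units.mk0 u⁻¹ (inv_ne_zero hu)) (κ := Units.mk0 v⁻¹ (inv_ne_zero hv))
    (by simpa using h2) (by simpa using h3)
  have hg := eisG1_smul γ z
  have hd := UpperHalfPlane.denom_ne_zero γ z
  have hz : ((γ • z : ℍ) : ℂ) = (γ 0 0 * z + γ 0 1) / denom γ z := by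
    rw [ModularGroup.denom_apply, UpperHalfPlane.specialLinearGroup_apply]
    simp
  have hdet : γ 0 0 * γ 1 1 - γ 0 1 * γ 1 0 = 1 := by
    rw [← Matrix.det_fin_two]; exact γ.det_coe
  have hdet' : (γ 0 0 * γ 1 1 - γ 0 1 * γ 1 0 : ℂ) = 1 := by exact_mod_cast hdet
  have hden := ModularGroup.denom_apply γ z
  simp only [Units.val_mk0] at hγ
  have hvu : v = u / denom γ z := by
    rw [← inv_inv v, hγ, mul_inv, inv_inv, div_eq_mul_inv]
  refine ⟨γ 0 0, γ 0 1, γ 1 0, γ 1 1, hdet, ?_, fun t₁ ↦ ?_⟩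
  · simp only [firstPeriods, hz, hγ]
    ext
    · field_simp
    · simp only [hden]; ring
  · have hk : v⁻¹ * t₁ - eisG1 (γ • z) * v =
        denom γ z * (u⁻¹ * t₁ - eisG1 z * u) - γ 1 0 * u := by
      rw [hg, hγ, hvu]
      field_simp
      ring
    simp only [secondPeriods, ofComplex_apply, hk]
    ext
    · rw [hz, hvu]
      generalize u⁻¹ * t₁ - eisG1 z * u = K
      field_simp
      rw [hden]
      linear_combination u * hdet'
    · simp only [hden]; ring

end Periods

/-! ### Analytic local sections -/

section LocalSection

open Filter Topology UpperHalfPlane ModularForm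
open scoped ContDiff

theorem differentiableOn_eisG1 : DifferentiableOn ℂ (eisG1 ∘ ofComplex) upperHalfPlaneSet := by
  have h := (UpperHalfPlane.mdifferentiable_iff.mp E2_mdifferentiable).const_mul
    (Real.pi * Complex.I / 6)
  exact h.congr fun w _ ↦ eisG1_eq _

theorem differentiableOn_eisG2 : DifferentiableOn ℂ (eisG2 ∘ ofComplex) upperHalfPlaneSet := by
  have h := (UpperHalfPlane.mdifferentiable_iff.mp (ModularFormClass.holo E₄)).const_mul
    (-(Real.pi ^ 2 / 3))
  exact h.congr fun w _ ↦ eisG2_eq _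

theorem differentiableOn_eisG3 : DifferentiableOn ℂ (eisG3 ∘ ofComplex) upperHalfPlaneSet := by
  have h := (UpperHalfPlane.mdifferentiable_iff.mp (ModularFormClass.holo E₆)).const_mul
    (-(Complex.I * Real.pi ^ 3 / 27))
  exact h.congr fun w _ ↦ eisG3_eq _

/-- The Jacobian determinant of `(z, u) ↦ (g₂(z) u⁴, g₃(z) u⁶)` does not vanish, being a multiple of
the Wronskian of `E₄` and `E₆`. -/
theorem jacobian_ne_zero (z : ℍ) :
    2 * eisG2 z * deriv (eisG3 ∘ ofComplex) z - 3 * eisG3 z * deriv (eisG2 ∘ ofComplex) z ≠ 0 := by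
  have h2 : eisG2 ∘ ofComplex = fun w ↦ -((Real.pi : ℂ) ^ 2 / 3) * (E₄ ∘ ofComplex) w :=
    funext fun w ↦ eisG2_eq _
  have h3 : eisG3 ∘ ofComplex =
      fun w ↦ -(Complex.I * (Real.pi : ℂ) ^ 3 / 27) * (E₆ ∘ ofComplex) w :=
    funext fun w ↦ eisG3_eq _
  have hpi : (Real.pi : ℂ) ≠ 0 := by exact_mod_cast Real.pi_ne_zero
  have hW : eisensteinWronskianFun z ≠ 0 := eisensteinWronskian_ne_zero z
  rw [eisensteinWronskianFun_apply] at hW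
  simp only [Derivative.normalizedDerivOfComplex] at hW
  rw [h2, h3, deriv_const_mul_field', deriv_const_mul_field', eisG2_eq, eisG3_eq]
  intro h
  apply hW
  have hc : (Real.pi : ℂ) ^ 2 / 3 * (Complex.I * (Real.pi : ℂ) ^ 3 / 27) ≠ 0 := by simp [hpi]
  apply mul_left_cancel₀ hc
  linear_combination (2 * Real.pi * Complex.I : ℂ)⁻¹ * h

/-- The map `(z, u) ↦ (g₂(z) u⁴, g₃(z) u⁶)`. -/
noncomputable def eisPairMap (p : ℂ × ℂ) : ℂ × ℂ :=
  (eisG2 (ofComplex p.1) * p.2 ^ 4, eisG3 (ofComplex p.1) * p.2 ^ 6)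

/-- Inverse function theorem for `(z, u) ↦ (g₂(z) u⁴, g₃(z) u⁶)`, with an analytic local inverse. -/
theorem exists_analytic_section (z : ℍ) {u : ℂ} (hu : u ≠ 0) :
    ∃ s : ℂ × ℂ → ℂ × ℂ, AnalyticAt ℂ s (eisPairMap (z, u)) ∧ s (eisPairMap (z, u)) = (↑z, u) ∧
      ∀ᶠ p in 𝓝 (eisPairMap (z, u)), eisPairMap (s p) = p := by
  have hz : (z : ℂ) ∈ upperHalfPlaneSet := z.im_pos
  have a2 : AnalyticAt ℂ (eisG2 ∘ ofComplex) (z : ℂ) :=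
    differentiableOn_eisG2.analyticAt (isOpen_upperHalfPlaneSet.mem_nhds hz)
  have a3 : AnalyticAt ℂ (eisG3 ∘ ofComplex) (z : ℂ) :=
    differentiableOn_eisG3.analyticAt (isOpen_upperHalfPlaneSet.mem_nhds hz)
  have han : AnalyticAt ℂ eisPairMap ((z : ℂ), u) := by
    have b2 : AnalyticAt ℂ (fun p : ℂ × ℂ ↦ (eisG2 ∘ ofComplex) p.1) ((z : ℂ), u) :=
      AnalyticAt.fun_comp (f := Prod.fst) a2 analyticAt_fst
    have b3 : AnalyticAt ℂ (fun p : ℂ × ℂ ↦ (eisG3 ∘ ofComplex) p.1) ((z : ℂ), u) :=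
      AnalyticAt.fun_comp (f := Prod.fst) a3 analyticAt_fst
    exact (b2.mul (analyticAt_snd.pow 4)).prod (b3.mul (analyticAt_snd.pow 6))
  have hcd : ContDiffAt ℂ ω eisPairMap ((z : ℂ), u) := han.contDiffAt
  have d2 := a2.differentiableAt.hasDerivAt
  have d3 := a3.differentiableAt.hasDerivAt
  have hf2 := (d2.comp_hasFDerivAt ((z : ℂ), u) hasFDerivAt_fst).mul
    ((hasFDerivAt_snd (𝕜 := ℂ) (p := ((z : ℂ), u))).pow 4)
  have hf3 := (d3.comp_hasFDerivAt ((z : ℂ), u) hasFDerivAt_fst).mul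
    ((hasFDerivAt_snd (𝕜 := ℂ) (p := ((z : ℂ), u))).pow 6)
  let f' : ℂ × ℂ →L[ℂ] ℂ × ℂ := ContinuousLinearMap.prod
    ((deriv (eisG2 ∘ ofComplex) z * u ^ 4) • ContinuousLinearMap.fst ℂ ℂ ℂ +
      (4 * eisG2 z * u ^ 3) • ContinuousLinearMap.snd ℂ ℂ ℂ)
    ((deriv (eisG3 ∘ ofComplex) z * u ^ 6) • ContinuousLinearMap.fst ℂ ℂ ℂ +
      (6 * eisG3 z * u ^ 5) • ContinuousLinearMap.snd ℂ ℂ ℂ)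
  have hf : HasFDerivAt eisPairMap f' ((z : ℂ), u) := by
    refine (hf2.prodMk hf3).congr_fderiv (ContinuousLinearMap.ext ?_)
    rintro ⟨x, y⟩
    ext <;> simp [f'] <;> ring
  have hinj : Function.Injective f' := by
    rw [← f'.coe_coe, ← LinearMap.ker_eq_bot, LinearMap.ker_eq_bot']
    rintro ⟨x, y⟩ hxy
    have h1 : deriv (eisG2 ∘ ofComplex) z * u ^ 4 * x + 4 * eisG2 z * u ^ 3 * y = 0 := by
      simpa [f'] using congrArg Prod.fst hxy
    have h2 : deriv (eisG3 ∘ ofComplex) z * u ^ 6 * x + 6 * eisG3 z * u ^ 5 * y = 0 := by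
      simpa [f'] using congrArg Prod.snd hxy
    have hJ := jacobian_ne_zero z
    generalize deriv (eisG2 ∘ ofComplex) z = A at *
    generalize deriv (eisG3 ∘ ofComplex) z = B at *
    have hx : (2 * eisG2 z * B - 3 * eisG3 z * A) * u ^ 9 * x = 0 := by
      linear_combination 2 * eisG2 z * u ^ 3 * h2 - 3 * eisG3 z * u ^ 5 * h1
    have hx0 : x = 0 := by simpa [hJ, hu] using hx
    subst hx0
    by_contra hne
    have hy : y ≠ 0 := fun h ↦ hne (by simp [h])
    have g2 : eisG2 z = 0 := by simpa [hu, hy] using h1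
    have g3 : eisG3 z = 0 := by simpa [hu, hy] using h2
    simp [g2, g3] at hJ
  let e : (ℂ × ℂ) ≃L[ℂ] (ℂ × ℂ) :=
    (LinearEquiv.ofInjectiveEndo (f' : ℂ × ℂ →ₗ[ℂ] ℂ × ℂ) hinj).toContinuousLinearEquiv
  have he : HasFDerivAt eisPairMap (e : ℂ × ℂ →L[ℂ] ℂ × ℂ) ((z : ℂ), u) :=
    hf.congr_fderiv (ContinuousLinearMap.ext fun _ ↦ rfl)
  refine ⟨hcd.localInverse he (by simp), ?_, ?_, ?_⟩
  · exact (hcd.to_localInverse he (by simp)).analyticAt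
  · exact hcd.localInverse_apply_image he (by simp)
  · exact (hcd.hasStrictFDerivAt' he (by simp)).eventually_right_inverse

end LocalSection

/-! ### The functions `B₁`, `B₂`, `B₃` -/

section Construction

open Filter Topology UpperHalfPlane

/-- A point `z ∈ ℍ` such that `t` lies over the lattice `k (ℤ z + ℤ)` for some `k`. -/
noncomputable def baseTau (t : regularLocus) : ℍ := (exists_eisG_eq t).choose

/-- The inverse `k⁻¹` of the scaling factor of the lattice `k (ℤ z + ℤ)` over which `t` lies, where
`z = baseTau t`. -/
noncomputable def baseU (t : regularLocus) : ℂ :=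
  ((exists_eisG_eq t).choose_spec.choose : ℂ)⁻¹

theorem baseU_ne_zero (t : regularLocus) : baseU t ≠ 0 := inv_ne_zero (Units.ne_zero _)

theorem base_spec (t : regularLocus) :
    t.1.2.1 = eisG2 (baseTau t) * baseU t ^ 4 ∧ t.1.2.2 = eisG3 (baseTau t) * baseU t ^ 6 :=
  (exists_eisG_eq t).choose_spec.choose_spec

/-- `B₁` is the area form of the first column of a period matrix. -/
noncomputable def periodB₁ (t : regularLocus) : ℝ :=
  areaForm (firstPeriods (baseTau t) (baseU t))

/-- `B₂` is the area form of the second column of a period matrix. -/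
noncomputable def periodB₂ (t : regularLocus) : ℝ :=
  areaForm (secondPeriods (baseTau t) (baseU t) t.1.1)

/-- `B₃` is the pairing of the two columns of a period matrix. -/
noncomputable def periodB₃ (t : regularLocus) : ℂ :=
  skewPairing (firstPeriods (baseTau t) (baseU t)) (secondPeriods (baseTau t) (baseU t) t.1.1)

/-- The functions `B₁`, `B₂`, `B₃` can be computed from any period matrix of `t`. -/
theorem periodB_eq (t : regularLocus) {z : ℍ} {u : ℂ} (hu : u ≠ 0)
    (h2 : t.1.2.1 = eisG2 z * u ^ 4) (h3 : t.1.2.2 = eisG3 z * u ^ 6) :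
    periodB₁ t = areaForm (firstPeriods z u) ∧
      periodB₂ t = areaForm (secondPeriods z u t.1.1) ∧
      periodB₃ t = skewPairing (firstPeriods z u) (secondPeriods z u t.1.1) := by
  obtain ⟨s2, s3⟩ := base_spec t
  obtain ⟨a, b, c, d, hdet, hf, hs⟩ := exists_periods_eq hu (baseU_ne_zero t)
    (h2.symm.trans s2) (h3.symm.trans s3)
  refine ⟨?_, ?_, ?_⟩
  · rw [periodB₁, hf, areaForm_of_det_eq_one hdet]
  · rw [periodB₂, hs, areaForm_of_det_eq_one hdet]
  · rw [periodB₃, hf, hs, skewPairing_of_det_eq_one hdet]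

theorem firstPeriods_scale (z u : ℂ) (k : ℂˣ) :
    firstPeriods z (u * (k : ℂ)⁻¹) = (k : ℂ) • firstPeriods z u := by
  ext
  · simp only [firstPeriods, Prod.smul_fst, smul_eq_mul, mul_inv, inv_inv]; ring
  · simp only [firstPeriods, Prod.smul_snd, smul_eq_mul, mul_inv, inv_inv]; ring

theorem secondPeriods_act (z t₁ k' : ℂ) {u : ℂ} (hu : u ≠ 0) (k : ℂˣ) :
    secondPeriods z (u * (k : ℂ)⁻¹) (t₁ * (k : ℂ)⁻¹ ^ 2 + k' * (k : ℂ)⁻¹) =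
      k' • firstPeriods z u + (k : ℂ)⁻¹ • secondPeriods z u t₁ := by
  have hk := k.ne_zero
  ext
  · simp only [firstPeriods, secondPeriods, Prod.fst_add, Prod.smul_fst, smul_eq_mul]
    field_simp
    ring
  · simp only [firstPeriods, secondPeriods, Prod.snd_add, Prod.smul_snd, smul_eq_mul]
    field_simp
    ring

/-- To prove real-analyticity on `T` it suffices to find analytic local extensions. -/
theorem realAnalyticOnT_of_local {E : Type*} [NormedAddCommGroup E] [NormedSpace ℝ E]
    {f : regularLocus → E}
    (h : ∀ t₀ : regularLocus, ∃ g : ℂ × ℂ × ℂ → E, AnalyticAt ℝ g t₀ ∧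
      ∀ᶠ t in 𝓝 (t₀ : ℂ × ℂ × ℂ), ∀ ht : t ∈ regularLocus, f ⟨t, ht⟩ = g t) :
    RealAnalyticOnT f := by
  classical
  have hopen : IsOpen regularLocus := isOpen_ne_fun (by fun_prop) continuous_const
  refine ⟨fun t ↦ if ht : t ∈ regularLocus then f ⟨t, ht⟩ else 0, fun t₀ ht₀ ↦ ?_, fun t ↦ ?_⟩
  · obtain ⟨g, hg, hfg⟩ := h ⟨t₀, ht₀⟩
    refine hg.congr ?_
    filter_upwards [hfg, hopen.mem_nhds ht₀] with t h1 h2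
    rw [dif_pos h2, h1 h2]
  · simp

theorem analyticAt_conj_comp {E : Type*} [NormedAddCommGroup E] [NormedSpace ℝ E]
    {f : E → ℂ} {x : E} (hf : AnalyticAt ℝ f x) : AnalyticAt ℝ (fun y ↦ conj (f y)) x :=
  (Complex.conjCLE.toContinuousLinearMap.analyticAt (f x)).fun_comp hf

theorem analyticAt_areaForm {E : Type*} [NormedAddCommGroup E] [NormedSpace ℝ E]
    {f g : E → ℂ} {x : E} (hf : AnalyticAt ℝ f x) (hg : AnalyticAt ℝ g x) :
    AnalyticAt ℝ (fun y ↦ areaForm (f y, g y)) x :=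
  AnalyticAt.fun_comp (g := Complex.im) (f := fun y ↦ f y * conj (g y))
    (Complex.imCLM.analyticAt _) (hf.mul (analyticAt_conj_comp hg))

/-- Near every point of `T` there is a period matrix depending analytically on the point. -/
theorem exists_local_periods (t₀ : regularLocus) :
    ∃ a₁ a₂ b₁ b₂ : ℂ × ℂ × ℂ → ℂ, AnalyticAt ℝ a₁ t₀ ∧ AnalyticAt ℝ a₂ t₀ ∧ AnalyticAt ℝ b₁ t₀ ∧
      AnalyticAt ℝ b₂ t₀ ∧ ∀ᶠ t in 𝓝 (t₀ : ℂ × ℂ × ℂ), ∀ ht : t ∈ regularLocus,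
        periodB₁ ⟨t, ht⟩ = areaForm (a₁ t, a₂ t) ∧ periodB₂ ⟨t, ht⟩ = areaForm (b₁ t, b₂ t) ∧
        periodB₃ ⟨t, ht⟩ = skewPairing (a₁ t, a₂ t) (b₁ t, b₂ t) := by
  have hp : eisPairMap (baseTau t₀, baseU t₀) = t₀.1.2 := by
    obtain ⟨s2, s3⟩ := base_spec t₀
    ext
    · simp [eisPairMap, s2]
    · simp [eisPairMap, s3]
  obtain ⟨s, hs, hs0, hsec⟩ := exists_analytic_section (baseTau t₀) (baseU_ne_zero t₀)
  rw [hp] at hs hs0 hsec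
  have hs' : AnalyticAt ℂ (fun t : ℂ × ℂ × ℂ ↦ s t.2) t₀ := hs.fun_comp analyticAt_snd
  have hz : AnalyticAt ℂ (fun t : ℂ × ℂ × ℂ ↦ (s t.2).1) t₀ := analyticAt_fst.fun_comp hs'
  have hu : AnalyticAt ℂ (fun t : ℂ × ℂ × ℂ ↦ (s t.2).2) t₀ := analyticAt_snd.fun_comp hs'
  have hu0 : (s t₀.1.2).2 ≠ 0 := by rw [hs0]; exact baseU_ne_zero t₀
  have hz0 : 0 < (s t₀.1.2).1.im := by rw [hs0]; exact (baseTau t₀).im_pos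
  have hui := hu.fun_inv hu0
  have ht1 : AnalyticAt ℂ (fun t : ℂ × ℂ × ℂ ↦ t.1) t₀ := analyticAt_fst
  have hg : AnalyticAt ℂ (fun t : ℂ × ℂ × ℂ ↦ eisG1 (ofComplex (s t.2).1)) t₀ :=
    AnalyticAt.fun_comp (g := eisG1 ∘ ofComplex) (f := fun t : ℂ × ℂ × ℂ ↦ (s t.2).1)
      (differentiableOn_eisG1.analyticAt (isOpen_upperHalfPlaneSet.mem_nhds hz0)) hz
  have hb2 := (hui.fun_mul ht1).fun_sub (hg.fun_mul hu)
  refine ⟨_, _, _, _, (hui.fun_mul hz).restrictScalars, hui.restrictScalars,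
    ((hz.fun_mul hb2).fun_sub hu).restrictScalars, hb2.restrictScalars, ?_⟩
  filter_upwards [continuousAt_snd.eventually hsec, hu.continuousAt.eventually_ne hu0,
    (Complex.continuous_im.continuousAt.comp hz.continuousAt).eventually (lt_mem_nhds hz0)]
    with t h1 h2 h3 ht
  have h3' : 0 < (s t.2).1.im := h3
  have hof : ((ofComplex (s t.2).1 : ℍ) : ℂ) = (s t.2).1 := by
    rw [ofComplex_apply_of_im_pos h3']
  have := periodB_eq ⟨t, ht⟩ (z := ofComplex (s t.2).1) h2 (congrArg Prod.fst h1).symm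
    (congrArg Prod.snd h1).symm
  rwa [hof] at this

theorem isBTriple_periodB :
    IsBTriple eisMap_mem_regularLocus periodB₁ periodB₂ periodB₃ where
  analytic₁ := realAnalyticOnT_of_local fun t₀ ↦ by
    obtain ⟨a₁, a₂, b₁, b₂, ha₁, ha₂, -, -, h⟩ := exists_local_periods t₀
    exact ⟨_, analyticAt_areaForm ha₁ ha₂, h.mono fun t ht h ↦ (ht h).1⟩
  analytic₂ := realAnalyticOnT_of_local fun t₀ ↦ by
    obtain ⟨a₁, a₂, b₁, b₂, -, -, hb₁, hb₂, h⟩ := exists_local_periods t₀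
    exact ⟨_, analyticAt_areaForm hb₁ hb₂, h.mono fun t ht h ↦ (ht h).2.1⟩
  analytic₃ := realAnalyticOnT_of_local fun t₀ ↦ by
    obtain ⟨a₁, a₂, b₁, b₂, ha₁, ha₂, hb₁, hb₂, h⟩ := exists_local_periods t₀
    exact ⟨_, (ha₁.mul (analyticAt_conj_comp hb₂)).sub (ha₂.mul (analyticAt_conj_comp hb₁)),
      h.mono fun t ht h ↦ (ht h).2.2⟩
  indep₁ s t hst := by
    obtain ⟨h2, h3⟩ := base_spec t
    exact (periodB_eq s (baseU_ne_zero t) (hst ▸ h2) (hst ▸ h3)).1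
  comp₁ z := by
    rw [(periodB_eq ⟨eisMap z, _⟩ (z := z) one_ne_zero (by simp [eisMap]) (by simp [eisMap])).1]
    simp [areaForm, firstPeriods]
  law₁ k t := by
    obtain ⟨h2, h3⟩ := base_spec t
    rw [(periodB_eq (scaleT k t) (z := baseTau t) (u := baseU t * (k : ℂ)⁻¹)
      (mul_ne_zero (baseU_ne_zero t) (inv_ne_zero k.ne_zero))
      (by simp only [scaleT, h2]; ring) (by simp only [scaleT, h3]; ring)).1,
      firstPeriods_scale, areaForm_smul, periodB₁]
  comp₂ z := by
    rw [(periodB_eq ⟨eisMap z, _⟩ (z := z) one_ne_zero (by simp [eisMap]) (by simp [eisMap])).2.1]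
    simp [areaForm, secondPeriods, eisMap]
  law₂ k k' t := by
    obtain ⟨h2, h3⟩ := base_spec t
    rw [(periodB_eq (actT k k' t) (z := baseTau t) (u := baseU t * (k : ℂ)⁻¹)
      (mul_ne_zero (baseU_ne_zero t) (inv_ne_zero k.ne_zero))
      (by simp only [actT, h2]; ring) (by simp only [actT, h3]; ring)).2.1]
    simp only [actT]
    rw [secondPeriods_act _ _ _ (baseU_ne_zero t), areaForm_smul_add_smul, periodB₁, periodB₂,
      periodB₃]
  comp₃ z := by
    rw [(periodB_eq ⟨eisMap z, _⟩ (z := z) one_ne_zero (by simp [eisMap]) (by simp [eisMap])).2.2]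
    simp [skewPairing, firstPeriods, secondPeriods, eisMap]
  law₃ k k' t := by
    obtain ⟨h2, h3⟩ := base_spec t
    rw [(periodB_eq (actT k k' t) (z := baseTau t) (u := baseU t * (k : ℂ)⁻¹)
      (mul_ne_zero (baseU_ne_zero t) (inv_ne_zero k.ne_zero))
      (by simp only [actT, h2]; ring) (by simp only [actT, h3]; ring)).2.2]
    simp only [actT]
    rw [firstPeriods_scale, secondPeriods_act _ _ _ (baseU_ne_zero t),
      skewPairing_smul_smul_add_smul, periodB₁, periodB₃]

/-- Every point of `T` is obtained from a point of the image of `g` by the action of an upper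
triangular matrix. -/
theorem exists_actT_eq (t : regularLocus) :
    ∃ (z : ℍ) (k : ℂˣ) (k' : ℂ), t = actT k k' ⟨eisMap z, eisMap_mem_regularLocus z⟩ := by
  obtain ⟨z, k, h2, h3⟩ := exists_eisG_eq t
  refine ⟨z, k, k * t.1.1 - eisG1 z * (k : ℂ)⁻¹, Subtype.ext (Prod.ext ?_ (Prod.ext h2 h3))⟩
  have hk := k.ne_zero
  simp only [actT, eisMap]
  field_simp
  ring

/-- The values on `g(ℍ)` and the transformation laws determine the triple, because every point of `T`
is of the form `actT k k' (g z)`. -/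
theorem IsBTriple.unique {hg : ∀ z : ℍ, eisMap z ∈ regularLocus} {B₁ B₂ C₁ C₂ : regularLocus → ℝ}
    {B₃ C₃ : regularLocus → ℂ} (hB : IsBTriple hg B₁ B₂ B₃) (hC : IsBTriple hg C₁ C₂ C₃) :
    C₁ = B₁ ∧ C₂ = B₂ ∧ C₃ = B₃ := by
  refine ⟨funext fun t ↦ ?_, funext fun t ↦ ?_, funext fun t ↦ ?_⟩ <;>
    obtain ⟨z, k, k', rfl⟩ := exists_actT_eq t
  · rw [hB.indep₁ (actT k k' ⟨eisMap z, hg z⟩) (scaleT k ⟨eisMap z, hg z⟩) rfl,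
      hC.indep₁ (actT k k' ⟨eisMap z, hg z⟩) (scaleT k ⟨eisMap z, hg z⟩) rfl,
      hB.law₁, hC.law₁, hB.comp₁, hC.comp₁]
  · rw [hB.law₂, hC.law₂, hB.comp₁, hC.comp₁, hB.comp₂, hC.comp₂, hB.comp₃, hC.comp₃]
  · rw [hB.law₃, hC.law₃, hB.comp₁, hC.comp₁, hB.comp₃, hC.comp₃]

/-- The polarisation identity for the two columns of the period matrix, whose determinant is one. -/
theorem norm_periodB₃_sq (t : regularLocus) :
    ‖periodB₃ t‖ ^ 2 = 4 * periodB₁ t * periodB₂ t + 1 := by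
  rw [periodB₁, periodB₂, periodB₃, norm_skewPairing_sq, det_periods _ _ (baseU_ne_zero t)]
  simp

end Construction

theorem theorem2 :
    ∃ hg : ∀ z : ℍ, eisMap z ∈ regularLocus,
      ∃ (B₁ B₂ : regularLocus → ℝ) (B₃ : regularLocus → ℂ),
        IsBTriple hg B₁ B₂ B₃ ∧
        (∀ (C₁ C₂ : regularLocus → ℝ) (C₃ : regularLocus → ℂ),
          IsBTriple hg C₁ C₂ C₃ → C₁ = B₁ ∧ C₂ = B₂ ∧ C₃ = B₃) ∧
        ∀ t : regularLocus, B₂ t = 0 → ‖B₃ t‖ = 1 := by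
  refine ⟨eisMap_mem_regularLocus, periodB₁, periodB₂, periodB₃, isBTriple_periodB,
    fun C₁ C₂ C₃ hC ↦ isBTriple_periodB.unique hC, fun t ht ↦ ?_⟩
  have h := norm_periodB₃_sq t
  rw [ht, mul_zero, zero_add] at h
  exact (pow_eq_one_iff_of_nonneg (norm_nonneg _) two_ne_zero).mp h
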